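/- A \emph{free diagram} is a closed curve (or several) drawn in the plane with transverse double points, the free crossings, at which no over/under information is recorded. An \emph{assignment} of a free diagram is a choice of the overstrand at each of its crossings; it gives a knot or link diagram, and two such diagrams represent the same knot or link if they are related by planar isotopies and Reidemeister moves. A knot and its mirror image are not distinguished. For $n\ge 0$, the \emph{free $2\ n$ knot} is the following free diagram with $n+2$ crossings. Take a vertical twist of two crossings (one crossing above the other, the lower left end of the upper crossing joined to the upper left end of the lower crossing, and likewise on the right), put to its right a horizontal twist of $n$ crossings (two parallel horizontal strands twisted $n$ times), join the two right ends of the first to the two left ends of the second, and close up: join the two free upper ends by an arc above the diagram and the two free lower ends by an arc below it. (This is the closure of Conway's tangle $2\ n$, with its crossings made free.) \textbf{Theorem.} Consider the $2^{n+2}$ assignments of the free $2\ n$ knot. (i) If $n$ is odd, exactly $2^{n+1}+2\binom{n}{(n-1)/2}$ of them represent the unknot, and exactly $2\binom{n}{(n-1)/2}$ of them represent a trefoil knot (left- or right-handed). (ii) If $n$ is even, exactly $2^{n+1}+2\binom{n}{n/2}$ of them represent the unknot. -/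

import Mathlib

/-!
# Link diagrams, free knot diagrams and Reidemeister moves

Plane diagrams are drawn in general position with respect to the horizontal coordinate and read
from left to right.  At each time a diagram is a stack of strands, numbered `0, 1, 2, …` from the
top downwards, and it is recorded as the list of the elementary events met on the way.
-/

namespace FreeKnot

/-- The elementary events of a plane diagram whose crossings carry labels in `C`: a left turning
point `⊂`, where two strands are born; a right turning point `⊃`, where two adjacent strands end;
a crossing `⨯` of two adjacent strands. -/
inductive Event (C : Type) : Type
  | cup : Event C
  | cap : Event C
  | cross (c : C) : Event C

namespace Event

/-- The number of strands that enter an event from the left. -/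
def inputs {C : Type} : Event C → ℕ
  | cup => 0
  | cap => 2
  | cross _ => 2

/-- The number of strands that leave an event to the right. -/
def outputs {C : Type} : Event C → ℕ
  | cup => 2
  | cap => 0
  | cross _ => 2

/-- Change the labels of the crossings. -/
def map {C C' : Type} (f : C → C') : Event C → Event C'
  | cup => cup
  | cap => cap
  | cross c => cross (f c)

end Event

/-- An event together with the number `pos` of strands that pass above it. -/
structure Slice (C : Type) : Type where
  event : Event C
  pos : ℕ

/-- `⊂` whose two new strands become the strands `i` and `i + 1`. -/
def cup {C : Type} (i : ℕ) : Slice C := ⟨.cup, i⟩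

/-- `⊃` joining the strands `i` and `i + 1`. -/
def cap {C : Type} (i : ℕ) : Slice C := ⟨.cap, i⟩

/-- A crossing of the strands `i` and `i + 1` with label `c`. -/
def cross {C : Type} (i : ℕ) (c : C) : Slice C := ⟨.cross c, i⟩

/-- Put `k` further strands above a slice. -/
def Slice.shift {C : Type} (k : ℕ) (s : Slice C) : Slice C := ⟨s.event, k + s.pos⟩

/-- Change the labels of the crossings. -/
def Slice.map {C C' : Type} (f : C → C') (s : Slice C) : Slice C' := ⟨s.event.map f, s.pos⟩

/-- `Runs m w n`: starting with `m` strands on the left, the events of `w` can be performed one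
after the other, and `n` strands remain on the right. -/
def Runs {C : Type} : ℕ → List (Slice C) → ℕ → Prop
  | m, [], n => m = n
  | m, s :: w, n => ∃ below : ℕ, m = s.pos + s.event.inputs + below ∧
      Runs (s.pos + s.event.outputs + below) w n

theorem Runs.append {C : Type} {v : List (Slice C)} {k n : ℕ} (hv : Runs k v n) :
    ∀ {u : List (Slice C)} {m : ℕ}, Runs m u k → Runs m (u ++ v) n
  | [], m, hu => by
      have h : m = k := hu
      subst h
      exact hv
  | s :: u, m, hu => by
      obtain ⟨b, hb, hu⟩ := hu
      exact ⟨b, hb, Runs.append hv hu⟩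

theorem Runs.map {C C' : Type} (f : C → C') :
    ∀ {w : List (Slice C)} {m n : ℕ}, Runs m w n → Runs m (w.map (Slice.map f)) n
  | [], _, _, h => h
  | ⟨e, i⟩ :: w, m, n, h => by
      obtain ⟨b, hb, h⟩ := h
      refine ⟨b, ?_, ?_⟩
      · cases e <;> exact hb
      · have h' := Runs.map f h
        cases e <;> exact h'

theorem Runs.shift {C : Type} :
    ∀ {w : List (Slice C)} {m n : ℕ}, Runs m w n →
      Runs (1 + m + 1) (w.map (Slice.shift 1)) (1 + n + 1)
  | [], m, n, h => by
      have h : m = n := h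
      subst h
      exact rfl
  | ⟨e, i⟩ :: w, m, n, h => by
      obtain ⟨b, hb, h⟩ := h
      refine ⟨b + 1, ?_, ?_⟩
      · simp only [Slice.shift] at hb ⊢
        omega
      · have h' := Runs.shift h
        simp only [Slice.shift] at h' ⊢
        convert h' using 1
        omega

/-- A plane tangle diagram with `m` end points on the left, `n` end points on the right, and
crossings labelled by `C`. -/
@[ext]
structure Tangle (C : Type) (m n : ℕ) : Type where
  word : List (Slice C)
  runs : Runs m word n

/-- A free diagram (knot or link): a closed plane curve whose double points, the free crossings,
carry no over/under information. -/
abbrev FreeDiagram : Type := Tangle Unit 0 0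

/-- A knot or link diagram.  A crossing is labelled `true` if its overstrand has positive slope,
that is, if the overstrand runs from the lower left to the upper right, and `false` if its
overstrand has negative slope. -/
abbrev LinkDiagram : Type := Tangle Bool 0 0

namespace Tangle

/-- Change the labels of the crossings. -/
def map {C C' : Type} {m n : ℕ} (f : C → C') (T : Tangle C m n) : Tangle C' m n :=
  ⟨T.word.map (Slice.map f), T.runs.map f⟩

/-- The shape of a diagram: all crossings are made into free crossings. -/
def shape {m n : ℕ} (T : Tangle Bool m n) : Tangle Unit m n := T.map fun _ => ()

/-- The horizontal sum: the right ends of `S` are joined to the left ends of `T`. -/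
def append {C : Type} {k m n : ℕ} (S : Tangle C k m) (T : Tangle C m n) : Tangle C k n :=
  ⟨S.word ++ T.word, Runs.append T.runs S.runs⟩

/-- The closure of a tangle with two left and two right ends: an arc above the tangle joins its
two upper ends, and an arc below the tangle joins its two lower ends. -/
def closure {C : Type} (T : Tangle C 2 2) : Tangle C 0 0 :=
  ⟨[cup 0, cup 2] ++ T.word.map (Slice.shift 1) ++ [cap 0, cap 0],
    Runs.append (k := 4) (show Runs 4 [cap 0, cap 0] 0 from ⟨2, rfl, 0, rfl, rfl⟩)
      (Runs.append (k := 4) T.runs.shift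
        (show Runs 0 [cup 0, cup 2] 4 from ⟨0, rfl, 0, rfl, rfl⟩))⟩

/-- The horizontal twist: two parallel horizontal strands, twisted `n` times, all crossings having
the same label. -/
def twist {C : Type} (c : C) (n : ℕ) : Tangle C 2 2 :=
  ⟨List.replicate n (cross 0 c), by
    induction n with
    | zero => exact rfl
    | succ n ih => exact ⟨0, rfl, ih⟩⟩

/-- The tangle `2` reflected in the diagonal of slope `-1`: a vertical twist, made of two crossings,
one above the other, where the lower left end of the upper crossing is joined to the upper left end
of the lower crossing, and likewise on the right. -/
def twoReflected {C : Type} (c : C) : Tangle C 2 2 :=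
  ⟨[cup 1, cross 0 c, cross 2 c, cap 1],
    1, rfl, 2, rfl, 0, rfl, 1, rfl, rfl⟩

end Tangle

/-- The free `2 n` tangle: Conway's product of the tangles `2` and `n`, with free crossings. -/
def freeTwoTangle (n : ℕ) : Tangle Unit 2 2 := (Tangle.twoReflected ()).append (Tangle.twist () n)

/-- The free `2 n` knot: the closure of the free `2 n` tangle. -/
def freeTwoKnot (n : ℕ) : FreeDiagram := (freeTwoTangle n).closure

/-- The local moves between diagrams.  The first five are planar isotopies, which change the
position of a diagram with respect to the horizontal coordinate; the others are the Reidemeister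
moves. -/
inductive LocalMove : List (Slice Bool) → List (Slice Bool) → Prop
  /-- Two events, one above the other, happen in the opposite order. -/
  | exchange (a b : Event Bool) (i k : ℕ) :
      LocalMove [⟨a, i⟩, ⟨b, i + a.outputs + k⟩] [⟨b, i + a.inputs + k⟩, ⟨a, i⟩]
  /-- A zigzag is straightened. -/
  | zigzag (i : ℕ) : LocalMove [cup i, cap (i + 1)] []
  | zigzag' (i : ℕ) : LocalMove [cup (i + 1), cap i] []
  /-- A turning point is moved along a strand through a crossing, which is turned by a right angle
  and so changes its slope type. -/
  | pivotCup (i : ℕ) (c : Bool) : LocalMove [cup i, cross (i + 1) c] [cup (i + 1), cross i (!c)]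
  | pivotCap (i : ℕ) (c : Bool) : LocalMove [cross (i + 1) c, cap i] [cross i (!c), cap (i + 1)]
  /-- Reidemeister I: a loop is untwisted. -/
  | reidemeister₁ (i : ℕ) (c : Bool) : LocalMove [cup i, cross i c] [cup i]
  | reidemeister₁' (i : ℕ) (c : Bool) : LocalMove [cross i c, cap i] [cap i]
  /-- Reidemeister II: one strand is over the other at both crossings. -/
  | reidemeister₂ (i : ℕ) (c : Bool) : LocalMove [cross i c, cross i (!c)] []
  /-- Reidemeister III: with `x, y, z` the strands that enter at `i, i + 1, i + 2`, the labels of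
  the crossings of `x, y`, of `x, z` and of `y, z` are `a`, `b` and `c` on both sides.  The
  condition says that the three strands lie at different heights, that is, that they do not pass
  over each other cyclically. -/
  | reidemeister₃ (i : ℕ) (a b c : Bool) (h : b = a ∨ b = c) :
      LocalMove [cross i a, cross (i + 1) b, cross i c] [cross (i + 1) c, cross i b, cross (i + 1) a]

/-- One diagram arises from another by one local move. -/
def Move {m n : ℕ} (D E : Tangle Bool m n) : Prop :=
  ∃ u l r v : List (Slice Bool), LocalMove l r ∧ D.word = u ++ l ++ v ∧ E.word = u ++ r ++ v

/-- Two diagrams represent the same link (or tangle): they are related by a finite sequence of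
planar isotopies and Reidemeister moves, used in either direction. -/
def Equivalent {m n : ℕ} (D E : Tangle Bool m n) : Prop := Relation.EqvGen Move D E

/-- The diagram of the unknot without crossings. -/
def circle : LinkDiagram := ⟨[cup 0, cap 0], 0, rfl, 0, rfl, rfl⟩

/-- The diagram represents the unknot. -/
def IsUnknot (D : LinkDiagram) : Prop := Equivalent D circle

/-- The diagram represents the trefoil, the closure of a `3` or `-3` tangle.  A knot and its mirror
image are not distinguished. -/
def IsTrefoil (D : LinkDiagram) : Prop := ∃ c : Bool, Equivalent D (Tangle.twist c 3).closure

/-- The number of assignments of the free diagram `F` that produce a knot with the property `P`.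
An assignment of `F` is a choice of the overstrand at each crossing of `F`, in other words a diagram
of shape `F`. -/
noncomputable def numberProduced (F : FreeDiagram) (P : LinkDiagram → Prop) : ℕ :=
  {D : LinkDiagram | D.shape = F ∧ P D}.ncard

end FreeKnot

/-! Let `a`, `b` be the labels of the two vertical crossings and `ls` those of the horizontal twist.
If `a ≠ b`, the vertical crossings cancel by a Reidemeister II move, the horizontal crossings become
kinks, and the diagram is an unknot: this gives `2 * 2 ^ n` assignments.

If `a = b`, opposite horizontal crossings cancel, so the knot depends only on `a` and on the signed
count `k = ls.count a - ls.count (!a)`. Explicit isotopies show that `k = 0` and `k = -1` give the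
unknot and `k = 1` gives a trefoil.

Fox colourings show that nothing else occurs. Over `ZMod m` the diagram has `m * #{t | (2 * k + 1) *
t = 0}` colourings, which for all `m` together determine the determinant `|2 * k + 1|`. It is 1 for
the unknot, so `k` is `0` or `-1`; it is 3 for the trefoil, so `k` is `1` or `-2`. Since `k` has the
parity of `n`, one value of `k` survives in each case of the theorem, and each choice of `a`
contributes one binomial coefficient (`isUnknot_assignment_iff`, `isTrefoil_assignment_iff`,
`card_count_eq`). -/

namespace FreeKnot

/-! ### Fox colourings and their invariance under the local moves -/

section Colorings

variable {A : Type} [CommRing A]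

/-- Insert two strands of colour `a` below the first `i` strands. -/
def insertPair (i : ℕ) (a : A) (s : ℕ → A) : ℕ → A := fun j =>
  if j < i then s j else if j < i + 2 then a else s (j - 2)

/-- Delete the strands `i` and `i + 1`. -/
def deletePair (i : ℕ) (s : ℕ → A) : ℕ → A := fun j => if j < i then s j else s (j + 2)

/-- The colours to the right of a crossing of the strands `i` and `i + 1`: the overstrand keeps its
colour, and the colour of the understrand is reflected in it. -/
def crossColors (i : ℕ) (c : Bool) (s : ℕ → A) : ℕ → A := fun j =>
  if j = i then (if c then s (i + 1) else 2 * s i - s (i + 1))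
  else if j = i + 1 then (if c then 2 * s (i + 1) - s i else s i)
  else s j

variable [Fintype A] [DecidableEq A]

/-- The number of Fox colourings by `A` of a word whose strands on the left have the colours `s`,
with infinitely many strands passing below. -/
def colorings : List (Slice Bool) → (ℕ → A) → ℕ
  | [], _ => 1
  | ⟨.cup, i⟩ :: w, s => ∑ a : A, colorings w (insertPair i a s)
  | ⟨.cap, i⟩ :: w, s => if s i = s (i + 1) then colorings w (deletePair i s) else 0
  | ⟨.cross c, i⟩ :: w, s => colorings w (crossColors i c s)

@[simp] theorem colorings_cup (i : ℕ) (w : List (Slice Bool)) (s : ℕ → A) :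
    colorings (cup i :: w) s = ∑ a : A, colorings w (insertPair i a s) := rfl

@[simp] theorem colorings_cap (i : ℕ) (w : List (Slice Bool)) (s : ℕ → A) :
    colorings (cap i :: w) s =
      if s i = s (i + 1) then colorings w (deletePair i s) else 0 := rfl

@[simp] theorem colorings_cross (i : ℕ) (c : Bool) (w : List (Slice Bool)) (s : ℕ → A) :
    colorings (cross i c :: w) s = colorings w (crossColors i c s) := rfl

/-- The two events act on disjoint sets of strands, so their effects on the colours commute once
positions are renumbered. The nine cases are the pairs of event types. -/
theorem colorings_exchange (a b : Event Bool) (i k : ℕ) (v : List (Slice Bool)) (s : ℕ → A) :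
    colorings (⟨a, i⟩ :: ⟨b, i + a.outputs + k⟩ :: v) s =
      colorings (⟨b, i + a.inputs + k⟩ :: ⟨a, i⟩ :: v) s := by
  rcases a with _ | _ | c <;> rcases b with _ | _ | d
  · change ∑ x, ∑ y, colorings v (insertPair (i + 2 + k) y (insertPair i x s)) =
      ∑ y, ∑ x, colorings v (insertPair i x (insertPair (i + 0 + k) y s))
    rw [Finset.sum_comm]
    refine Finset.sum_congr rfl fun x _ => Finset.sum_congr rfl fun y _ => ?_
    congr 1; funext j; grind [insertPair]
  · change (∑ x, if insertPair i x s (i + 2 + k) = insertPair i x s (i + 2 + k + 1) then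
        colorings v (deletePair (i + 2 + k) (insertPair i x s)) else 0) =
      if s (i + 0 + k) = s (i + 0 + k + 1) then
        ∑ x, colorings v (insertPair i x (deletePair (i + 0 + k) s)) else 0
    have h (x : A) : deletePair (i + 2 + k) (insertPair i x s) =
        insertPair i x (deletePair (i + 0 + k) s) := by
      funext j; grind [insertPair, deletePair]
    have h' (x : A) : insertPair i x s (i + 2 + k) = insertPair i x s (i + 2 + k + 1) ↔
        s (i + 0 + k) = s (i + 0 + k + 1) := by
      grind [insertPair]
    simp only [h, h']
    split_ifs <;> simp
  · change (∑ x, colorings v (crossColors (i + 2 + k) d (insertPair i x s))) =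
      ∑ x, colorings v (insertPair i x (crossColors (i + 0 + k) d s))
    refine Finset.sum_congr rfl fun x _ => ?_
    congr 1; funext j; grind [insertPair, crossColors]
  · change (if s i = s (i + 1) then
        ∑ x, colorings v (insertPair (i + 0 + k) x (deletePair i s)) else 0) =
      ∑ x, if insertPair (i + 2 + k) x s i = insertPair (i + 2 + k) x s (i + 1) then
        colorings v (deletePair i (insertPair (i + 2 + k) x s)) else 0
    have h (x : A) : deletePair i (insertPair (i + 2 + k) x s) =
        insertPair (i + 0 + k) x (deletePair i s) := by
      funext j; grind [insertPair, deletePair]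
    have h' (x : A) : insertPair (i + 2 + k) x s i = insertPair (i + 2 + k) x s (i + 1) ↔
        s i = s (i + 1) := by
      grind [insertPair]
    simp only [h, h']
    split_ifs <;> simp
  · change (if s i = s (i + 1) then if deletePair i s (i + 0 + k) = deletePair i s (i + 0 + k + 1)
        then colorings v (deletePair (i + 0 + k) (deletePair i s)) else 0 else 0) =
      if s (i + 2 + k) = s (i + 2 + k + 1) then if deletePair (i + 2 + k) s i =
        deletePair (i + 2 + k) s (i + 1) then
          colorings v (deletePair i (deletePair (i + 2 + k) s)) else 0 else 0
    have h : deletePair (i + 0 + k) (deletePair i s) = deletePair i (deletePair (i + 2 + k) s) := by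
      funext j; grind [deletePair]
    rw [h]
    grind [deletePair]
  · change (if s i = s (i + 1) then colorings v (crossColors (i + 0 + k) d (deletePair i s)) else
    0) =
      if crossColors (i + 2 + k) d s i = crossColors (i + 2 + k) d s (i + 1) then
        colorings v (deletePair i (crossColors (i + 2 + k) d s)) else 0
    have h : crossColors (i + 0 + k) d (deletePair i s) =
        deletePair i (crossColors (i + 2 + k) d s) := by
      funext j; grind [deletePair, crossColors]
    rw [h]
    grind [crossColors]
  · change (∑ x, colorings v (insertPair (i + 2 + k) x (crossColors i c s))) =
      ∑ x, colorings v (crossColors i c (insertPair (i + 2 + k) x s))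
    refine Finset.sum_congr rfl fun x _ => ?_
    congr 1; funext j; grind [insertPair, crossColors]
  · change (if crossColors i c s (i + 2 + k) = crossColors i c s (i + 2 + k + 1) then
        colorings v (deletePair (i + 2 + k) (crossColors i c s)) else 0) =
      if s (i + 2 + k) = s (i + 2 + k + 1) then
        colorings v (crossColors i c (deletePair (i + 2 + k) s)) else 0
    have h : deletePair (i + 2 + k) (crossColors i c s) =
        crossColors i c (deletePair (i + 2 + k) s) := by
      funext j; grind [deletePair, crossColors]
    rw [h]
    grind [crossColors]
  · change colorings v (crossColors (i + 2 + k) d (crossColors i c s)) =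
      colorings v (crossColors i c (crossColors (i + 2 + k) d s))
    congr 1; funext j; grind [crossColors]

/-- Each move matches the colours of new arcs on its two sides and yields the same colours on the
right. Arbitrary `s` and `v` are needed so that the move can later be placed inside a diagram. -/
theorem colorings_localMove {l r : List (Slice Bool)} (h : LocalMove l r) (v : List (Slice Bool))
    (s : ℕ → A) : colorings (l ++ v) s = colorings (r ++ v) s := by
  cases h with
  | exchange a b i k => exact colorings_exchange a b i k v s
  | zigzag i =>
    simp only [List.cons_append, List.nil_append, colorings_cup, colorings_cap]
    have h1 (a : A) : insertPair i a s (i + 1) = a := by simp [insertPair]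
    have h2 (a : A) : insertPair i a s (i + 1 + 1) = s i := by grind [insertPair]
    simp only [h1, h2, Finset.sum_ite_eq', Finset.mem_univ, if_true]
    congr 1; funext j; grind [insertPair, deletePair]
  | zigzag' i =>
    simp only [List.cons_append, List.nil_append, colorings_cup, colorings_cap]
    have h1 (a : A) : insertPair (i + 1) a s i = s i := by simp [insertPair]
    have h2 (a : A) : insertPair (i + 1) a s (i + 1) = a := by simp [insertPair]
    simp only [h1, h2, Finset.sum_ite_eq, Finset.mem_univ, if_true]
    congr 1; funext j; grind [insertPair, deletePair]
  | pivotCup i c =>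
    simp only [List.cons_append, List.nil_append, colorings_cup, colorings_cross]
    cases c
    · refine Finset.sum_congr rfl fun a _ => ?_
      congr 1; funext j; grind [insertPair, crossColors]
    -- Here the arc born at the cup passes under the strand of colour `s i`, so the cups on the two
    -- sides carry colours that are reflections of each other in `s i`.
    · refine Fintype.sum_equiv (Equiv.subLeft (2 * s i)) _ _ fun a => ?_
      congr 1; funext j; simp only [Equiv.subLeft_apply]; grind [insertPair, crossColors]
  | pivotCap i c =>
    simp only [List.cons_append, List.nil_append, colorings_cap, colorings_cross]
    have h : crossColors (i + 1) c s i = crossColors (i + 1) c s (i + 1) ↔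
        crossColors i (!c) s (i + 1) = crossColors i (!c) s (i + 1 + 1) := by
      grind [crossColors]
    simp only [h]
    refine ite_congr rfl (fun h' => ?_) fun _ => rfl
    congr 1; funext j; grind [deletePair, crossColors]
  | reidemeister₁ i c =>
    simp only [List.cons_append, List.nil_append, colorings_cup, colorings_cross]
    refine Finset.sum_congr rfl fun a _ => ?_
    congr 1; funext j; grind [insertPair, crossColors]
  | reidemeister₁' i c =>
    simp only [List.cons_append, List.nil_append, colorings_cap, colorings_cross]
    have h : deletePair i (crossColors i c s) = deletePair i s := by
      funext j; grind [deletePair, crossColors]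
    rw [h]
    grind [crossColors]
  | reidemeister₂ i c =>
    simp only [List.cons_append, List.nil_append, colorings_cross]
    congr 1; funext j; grind [crossColors]
  | reidemeister₃ i a b c h =>
    simp only [List.cons_append, List.nil_append, colorings_cross]
    congr 1; funext j; grind [crossColors]

theorem colorings_append_congr {w w' : List (Slice Bool)}
    (h : ∀ s : ℕ → A, colorings w s = colorings w' s) :
    ∀ (u : List (Slice Bool)) (s : ℕ → A), colorings (u ++ w) s = colorings (u ++ w') s
  | [], s => h s
  | ⟨e, i⟩ :: u, s => by
    cases e <;> simp only [List.cons_append, colorings, colorings_append_congr h u]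

/-- Equivalent diagrams have equally many Fox colourings. -/
theorem Equivalent.colorings_eq {m n : ℕ} {D E : Tangle Bool m n} (h : Equivalent D E)
    (s : ℕ → A) : colorings D.word s = colorings E.word s := by
  induction h with
  | rel D E h =>
    obtain ⟨u, l, r, v, h, hD, hE⟩ := h
    rw [hD, hE, List.append_assoc, List.append_assoc]
    exact colorings_append_congr (colorings_localMove h v) u s
  | refl D => rfl
  | symm D E _ ih => exact ih.symm
  | trans D E F _ _ ih ih' => exact ih.trans ih'

/-! ### The colouring numbers of the diagrams in question -/

/-- The total effect of a horizontal twist on the colours. -/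
theorem colorings_twist (v : List (Slice Bool)) : ∀ (ls : List Bool) (s : ℕ → A),
    colorings (ls.map (cross 1) ++ v) s = colorings v fun j =>
      if j = 1 ∨ j = 2 then s j + ((ls.count true : A) - ls.count false) * (s 2 - s 1) else s j
  | [], s => by simp
  | c :: ls, s => by
    rw [List.map_cons, List.cons_append, colorings_cross, colorings_twist v ls]
    -- A crossing adds `±(s 2 - s 1)` to both colours and keeps their difference, so the effects of
    -- successive crossings add up.
    congr 1; funext j
    cases c <;> simp [crossColors] <;> grind

/-- The word of an assignment of the free `2 n` knot: the labels of the vertical twist are `a` and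
`b`, those of the horizontal twist are `ls`. -/
def assignmentWord (a b : Bool) (ls : List Bool) : List (Slice Bool) :=
  [cup 0, cup 2, cup 2, cross 1 a, cross 3 b, cap 2] ++ (ls.map (cross 1) ++ [cap 0, cap 0])

/-- Translation by `x` replaces `y` by `t = y - x`, and every `x` contributes equally. In the
applications `d` is the determinant up to sign. -/
theorem sum_eq_card_mul {f : A → A → ℕ} (d : A)
    (h : ∀ x y, f x y = if d * (y - x) = 0 then 1 else 0) :
    ∑ x, ∑ y, f x y =
      Fintype.card A * (Finset.univ.filter fun t : A => d * t = 0).card := by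
  have hx (x : A) : ∑ y, f x y = (Finset.univ.filter fun t : A => d * t = 0).card := by
    rw [Finset.card_filter]
    refine Fintype.sum_equiv (Equiv.subRight x) _ _ fun y => ?_
    rw [h, Equiv.subRight_apply]
  simp only [hx, Finset.sum_const, smul_eq_mul, Finset.card_univ]

/-- Let `x`, `y`, `z` be the colours of the three cups. The inner cap forces `y = 2 * z - x`, and
the twist then starts with two colours differing by `2 * (z - x)`. By `colorings_twist` the first
closing cap says that the determinant kills `z - x`, and the last cap adds no condition. -/
theorem colorings_assignmentWord (a : Bool) (ls : List Bool) :
    colorings (assignmentWord a a ls) (fun _ => (0 : A)) =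
      Fintype.card A * (Finset.univ.filter fun t : A =>
        (2 * ((ls.count a : A) - ls.count (!a)) + 1) * t = 0).card := by
  have key {f : A → A → A → ℕ} (d : A) (h : ∀ x y z, f x y z =
      if y = 2 * z - x then if d * (z - x) = 0 then 1 else 0 else 0) :
      ∑ x, ∑ y, ∑ z, f x y z =
        Fintype.card A * (Finset.univ.filter fun t : A => d * t = 0).card := by
    rw [← sum_eq_card_mul (f := fun x z => if d * (z - x) = 0 then 1 else 0) d fun _ _ => rfl]
    refine Finset.sum_congr rfl fun x _ => ?_
    rw [Finset.sum_comm]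
    simp only [h, Finset.sum_ite_eq', Finset.mem_univ, if_true]
  simp only [assignmentWord, List.cons_append, List.nil_append, colorings_cup, colorings_cap,
    colorings_cross, colorings_twist]
  cases a
  · simp only [insertPair, deletePair, crossColors, colorings]
    refine key _ fun x y z => ?_
    simp
    generalize (List.count true ls : A) = p
    generalize (List.count false ls : A) = q
    grind
  · simp only [insertPair, deletePair, crossColors, colorings]
    refine key _ fun x y z => ?_
    simp
    generalize (List.count true ls : A) = p
    generalize (List.count false ls : A) = q
    grind

theorem colorings_circle :
    colorings circle.word (fun _ => (0 : A)) = Fintype.card A := by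
  simp [circle, insertPair, colorings]

theorem colorings_closure_twist_three (c : Bool) :
    colorings (Tangle.twist c 3).closure.word (fun _ => (0 : A)) =
      Fintype.card A * (Finset.univ.filter fun t : A => 3 * t = 0).card := by
  simp only [Tangle.closure, Tangle.twist, List.replicate, List.map_cons, List.map_nil,
    List.cons_append, List.nil_append, Slice.shift, cross, colorings, colorings_cup, colorings_cap]
  refine sum_eq_card_mul _ fun x y => ?_
  cases c <;> simp [insertPair, deletePair, crossColors] <;> grind

end Colorings
-- Rewriting words inside diagrams
/-- The number of strands to the right of a word, if its events can be performed. -/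
def finish {C : Type} : List (Slice C) → ℕ → Option ℕ
  | [], m => some m
  | s :: w, m =>
    if s.pos + s.event.inputs ≤ m then finish w (m - s.event.inputs + s.event.outputs) else none

/-- Reduces the well-formedness of an explicit word to a computation, so that `rfl` proves it in the
isotopies. -/
theorem finish_eq_some_iff {C : Type} {n : ℕ} : ∀ {w : List (Slice C)} {m : ℕ},
    finish w m = some n ↔ Runs m w n
  | [], m => by simp [finish, Runs]
  | s :: w, m => by
    rw [finish, Runs]
    split_ifs with h
    · rw [finish_eq_some_iff]
      obtain ⟨b, rfl⟩ := Nat.exists_eq_add_of_le h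
      have hb : s.pos + s.event.inputs + b - s.event.inputs + s.event.outputs =
          s.pos + s.event.outputs + b := by omega
      rw [hb]
      refine ⟨fun h => ⟨b, rfl, h⟩, ?_⟩
      rintro ⟨b', hb', h⟩
      obtain rfl : b = b' := by omega
      exact h
    · simp only [false_iff, not_exists, not_and]
      intro b hb
      omega

/-- Two words are tangle diagrams with the same end points, and these are equivalent. -/
def Similar (m n : ℕ) (w w' : List (Slice Bool)) : Prop :=
  ∃ (h : Runs m w n) (h' : Runs m w' n),
    Equivalent (⟨w, h⟩ : Tangle Bool m n) ⟨w', h'⟩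

namespace Similar

variable {k m n : ℕ} {w w' w'' : List (Slice Bool)}

theorem refl (h : Runs m w n) : Similar m n w w := ⟨h, h, .refl _⟩

theorem symm : Similar m n w w' → Similar m n w' w
  | ⟨h, h', e⟩ => ⟨h', h, .symm _ _ e⟩

theorem trans : Similar m n w w' → Similar m n w' w'' → Similar m n w w''
  | ⟨h, _, e⟩, ⟨_, h', e'⟩ => ⟨h, h', .trans _ _ _ e e'⟩

instance : Trans (Similar m n) (Similar m n) (Similar m n) := ⟨trans⟩

theorem of_localMove {l r : List (Slice Bool)} (hlr : LocalMove l r)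
    (hl : finish l m = some n) (hr : finish r m = some n) : Similar m n l r :=
  ⟨finish_eq_some_iff.1 hl, finish_eq_some_iff.1 hr, .rel _ _ ⟨[], l, r, [], hlr, by simp, by simp⟩⟩

theorem append_left {u : List (Slice Bool)} (hu : Runs k u m) :
    Similar m n w w' → Similar k n (u ++ w) (u ++ w')
  | ⟨h, h', e⟩ => by
    refine ⟨h.append hu, h'.append hu, ?_⟩
    have key {D E : Tangle Bool m n} (e : Equivalent D E) :
        Equivalent (Tangle.append ⟨u, hu⟩ D) (Tangle.append ⟨u, hu⟩ E) := by
      induction e with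
      | rel D E h =>
        obtain ⟨x, l, r, v, h, hD, hE⟩ := h
        refine .rel _ _ ⟨u ++ x, l, r, v, h, ?_, ?_⟩ <;> simp [Tangle.append, hD, hE]
      | refl D => exact .refl _
      | symm D E _ ih => exact .symm _ _ ih
      | trans D E F _ _ ih ih' => exact .trans _ _ _ ih ih'
    exact key e

theorem append_right {v : List (Slice Bool)} (hv : Runs n v k) :
    Similar m n w w' → Similar m k (w ++ v) (w' ++ v)
  | ⟨h, h', e⟩ => by
    refine ⟨hv.append h, hv.append h', ?_⟩
    have key {D E : Tangle Bool m n} (e : Equivalent D E) :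
        Equivalent (Tangle.append D ⟨v, hv⟩) (Tangle.append E ⟨v, hv⟩) := by
      induction e with
      | rel D E h =>
        obtain ⟨x, l, r, y, h, hD, hE⟩ := h
        refine .rel _ _ ⟨x, l, r, y ++ v, h, ?_, ?_⟩ <;> simp [Tangle.append, hD, hE]
      | refl D => exact .refl _
      | symm D E _ ih => exact .symm _ _ ih
      | trans D E F _ _ ih ih' => exact .trans _ _ _ ih ih'
    exact key e

/-- A local move inside a word. -/
theorem move {l r : List (Slice Bool)} (u v : List (Slice Bool)) (hlr : LocalMove l r)
    (hl : finish (u ++ l ++ v) m = some n) (hr : finish (u ++ r ++ v) m = some n) :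
    Similar m n (u ++ l ++ v) (u ++ r ++ v) :=
  ⟨finish_eq_some_iff.1 hl, finish_eq_some_iff.1 hr, .rel _ _ ⟨u, l, r, v, hlr, rfl, rfl⟩⟩

/-- A local move inside a word, in the opposite direction. -/
theorem move_symm {l r : List (Slice Bool)} (u v : List (Slice Bool)) (hlr : LocalMove l r)
    (hl : finish (u ++ l ++ v) m = some n) (hr : finish (u ++ r ++ v) m = some n) :
    Similar m n (u ++ r ++ v) (u ++ l ++ v) :=
  (move u v hlr hl hr).symm

end Similar

namespace LocalMove

theorem pivotCup_not (i : ℕ) (c : Bool) :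
    LocalMove [cup i, cross (i + 1) (!c)] [cup (i + 1), cross i c] := by
  simpa using pivotCup i (!c)

theorem pivotCap_not (i : ℕ) (c : Bool) :
    LocalMove [cross (i + 1) (!c), cap i] [cross i c, cap (i + 1)] := by
  simpa using pivotCap i (!c)

theorem reidemeister₂_not (i : ℕ) (c : Bool) : LocalMove [cross i (!c), cross i c] [] := by
  simpa using reidemeister₂ i (!c)

end LocalMove

open FreeKnot.Similar FreeKnot.LocalMove

/-! ### Explicit isotopies for the reduced diagrams -/

section Isotopies

variable (c : Bool)

local infix:50 " ∼ " => Similar 0 4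

/-- Pivoting both crossings around their turning points puts them side by side on the same two
strands, where opposite labels cancel. Two nested arcs remain. -/
theorem similar_of_vertical_ne : [cup 0, cup 2, cup 2, cross 1 c, cross 3 (!c), cap 2] ∼ [cup 0,
  cup 1] :=
  calc [cup 0, cup 2, cup 2, cross 1 c, cross 3 (!c), cap 2]
    _ ∼ [cup 0, cup 2, cup 2, cross 1 c, cross 2 c, cap 3] :=
      move [cup 0, cup 2, cup 2, cross 1 c] [] (pivotCap_not 2 c) rfl rfl
    _ ∼ [cup 0, cup 2, cup 1, cross 2 (!c), cross 2 c, cap 3] :=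
      move_symm [cup 0, cup 2] [cross 2 c, cap 3] (pivotCup_not 1 c) rfl rfl
    _ ∼ [cup 0, cup 2, cup 1, cap 3] :=
      move [cup 0, cup 2, cup 1] [cap 3] (reidemeister₂_not 2 c) rfl rfl
    _ ∼ [cup 0, cup 2, cap 1, cup 1] :=
      move [cup 0, cup 2] [] (exchange .cup .cap 1 0) rfl rfl
    _ ∼ [cup 0, cup 1] :=
      move [cup 0] [cup 1] (zigzag' 1) rfl rfl

end Isotopies

section Isotopies

variable (c : Bool)

local infix:50 " ∼ " => Similar 0 0

/-- The `2 0` knot is trivial. -/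
theorem similar_two_zero : [cup 0, cup 2, cup 2, cross 1 c, cross 3 c, cap 2, cap 0, cap 0]
    ∼ [cup 0, cap 0] :=
  calc [cup 0, cup 2, cup 2, cross 1 c, cross 3 c, cap 2, cap 0, cap 0]
    _ ∼ [cup 0, cup 2, cup 2, cross 1 c, cross 3 c, cap 0, cap 0, cap 0] :=
      move_symm [cup 0, cup 2, cup 2, cross 1 c, cross 3 c] [cap 0] (exchange .cap .cap 0 0) rfl rfl
    _ ∼ [cup 0, cup 2, cup 2, cross 1 c, cap 0, cross 1 c, cap 0, cap 0] :=
      move_symm [cup 0, cup 2, cup 2, cross 1 c] [cap 0, cap 0] (exchange .cap (.cross c) 0 1) rfl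
        rfl
    _ ∼ [cup 0, cup 2, cup 2, cross 0 (!c), cap 1, cross 1 c, cap 0, cap 0] :=
      move [cup 0, cup 2, cup 2] [cross 1 c, cap 0, cap 0] (pivotCap 0 c) rfl rfl
    _ ∼ [cup 0, cup 2, cross 0 (!c), cup 2, cap 1, cross 1 c, cap 0, cap 0] :=
      move_symm [cup 0, cup 2] [cap 1, cross 1 c, cap 0, cap 0] (exchange (.cross (!c)) .cup 0 0)
        rfl rfl
    _ ∼ [cup 0, cross 0 (!c), cup 2, cup 2, cap 1, cross 1 c, cap 0, cap 0] :=
      move_symm [cup 0] [cup 2, cap 1, cross 1 c, cap 0, cap 0] (exchange (.cross (!c)) .cup 0 0)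
        rfl rfl
    _ ∼ [cup 0, cup 2, cup 2, cap 1, cross 1 c, cap 0, cap 0] :=
      move [] [cup 2, cup 2, cap 1, cross 1 c, cap 0, cap 0] (reidemeister₁ 0 (!c)) rfl rfl
    _ ∼ [cup 0, cup 2, cross 1 c, cap 0, cap 0] :=
      move [cup 0, cup 2] [cross 1 c, cap 0, cap 0] (zigzag' 1) rfl rfl
    _ ∼ [cup 0, cup 2, cross 0 (!c), cap 1, cap 0] :=
      move [cup 0, cup 2] [cap 0] (pivotCap 0 c) rfl rfl
    _ ∼ [cup 0, cross 0 (!c), cup 2, cap 1, cap 0] :=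
      move_symm [cup 0] [cap 1, cap 0] (exchange (.cross (!c)) .cup 0 0) rfl rfl
    _ ∼ [cup 0, cup 2, cap 1, cap 0] :=
      move [] [cup 2, cap 1, cap 0] (reidemeister₁ 0 (!c)) rfl rfl
    _ ∼ [cup 0, cap 0] :=
      move [cup 0] [cap 0] (zigzag' 1) rfl rfl

/-- The `2 -1` knot is trivial. -/
theorem similar_two_neg_one : [cup 0, cup 2, cup 2, cross 1 c, cross 3 c, cap 2, cross 1 (!c), cap
  0, cap 0] ∼ [cup 0, cap 0] :=
  calc [cup 0, cup 2, cup 2, cross 1 c, cross 3 c, cap 2, cross 1 (!c), cap 0, cap 0]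
    _ ∼ [cup 0, cup 2, cup 2, cross 1 c, cross 2 (!c), cap 3, cross 1 (!c), cap 0, cap 0] :=
      move [cup 0, cup 2, cup 2, cross 1 c] [cross 1 (!c), cap 0, cap 0] (pivotCap 2 c) rfl rfl
    _ ∼ [cup 0, cup 2, cup 1, cross 2 (!c), cross 2 (!c), cap 3, cross 1 (!c), cap 0, cap 0] :=
      move_symm [cup 0, cup 2] [cross 2 (!c), cap 3, cross 1 (!c), cap 0, cap 0] (pivotCup_not 1 c)
        rfl rfl
    _ ∼ [cup 0, cup 2, cup 1, cross 2 (!c), cross 2 (!c), cross 1 (!c), cap 3, cap 0, cap 0] :=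
      move_symm [cup 0, cup 2, cup 1, cross 2 (!c), cross 2 (!c)] [cap 0, cap 0] (exchange (.cross
        (!c)) .cap 1 0) rfl rfl
    _ ∼ [cup 0, cup 2, cup 1, cross 2 (!c), cross 2 (!c), cross 1 (!c), cap 0, cap 1, cap 0] :=
      move_symm [cup 0, cup 2, cup 1, cross 2 (!c), cross 2 (!c), cross 1 (!c)] [cap 0] (exchange
        .cap .cap 0 1) rfl rfl
    _ ∼ [cup 0, cup 2, cup 1, cross 2 (!c), cross 2 (!c), cross 0 c, cap 1, cap 1, cap 0] :=
      move [cup 0, cup 2, cup 1, cross 2 (!c), cross 2 (!c)] [cap 1, cap 0] (pivotCap_not 0 c) rfl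
        rfl
    _ ∼ [cup 0, cup 2, cup 1, cross 2 (!c), cross 0 c, cross 2 (!c), cap 1, cap 1, cap 0] :=
      move_symm [cup 0, cup 2, cup 1, cross 2 (!c)] [cap 1, cap 1, cap 0] (exchange (.cross c)
        (.cross (!c)) 0 0) rfl rfl
    _ ∼ [cup 0, cup 2, cup 1, cross 0 c, cross 2 (!c), cross 2 (!c), cap 1, cap 1, cap 0] :=
      move_symm [cup 0, cup 2, cup 1] [cross 2 (!c), cap 1, cap 1, cap 0] (exchange (.cross c)
        (.cross (!c)) 0 0) rfl rfl
    _ ∼ [cup 0, cup 2, cup 0, cross 1 (!c), cross 2 (!c), cross 2 (!c), cap 1, cap 1, cap 0] :=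
      move_symm [cup 0, cup 2] [cross 2 (!c), cross 2 (!c), cap 1, cap 1, cap 0] (pivotCup_not 0 c)
        rfl rfl
    _ ∼ [cup 0, cup 2, cup 0, cross 1 (!c), cross 2 (!c), cross 1 c, cap 2, cap 1, cap 0] :=
      move [cup 0, cup 2, cup 0, cross 1 (!c), cross 2 (!c)] [cap 1, cap 0] (pivotCap_not 1 c) rfl
        rfl
    -- The only Reidemeister III move. After it, pivots and exchanges turn the three crossings into
    -- kinks, one at a time.
    _ ∼ [cup 0, cup 2, cup 0, cross 2 c, cross 1 (!c), cross 2 (!c), cap 2, cap 1, cap 0] :=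
      move [cup 0, cup 2, cup 0] [cap 2, cap 1, cap 0] (reidemeister₃ 1 (!c) (!c) c (.inl rfl)) rfl
        rfl
    _ ∼ [cup 0, cup 2, cup 0, cross 2 c, cross 1 (!c), cap 2, cap 1, cap 0] :=
      move [cup 0, cup 2, cup 0, cross 2 c, cross 1 (!c)] [cap 1, cap 0] (reidemeister₁' 2 (!c))
        rfl rfl
    _ ∼ [cup 0, cup 2, cup 0, cross 2 c, cross 2 c, cap 1, cap 1, cap 0] :=
      move_symm [cup 0, cup 2, cup 0, cross 2 c] [cap 1, cap 0] (pivotCap 1 c) rfl rfl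
    _ ∼ [cup 0, cup 2, cross 0 c, cup 0, cross 2 c, cap 1, cap 1, cap 0] :=
      move [cup 0, cup 2] [cross 2 c, cap 1, cap 1, cap 0] (exchange .cup (.cross c) 0 0) rfl rfl
    _ ∼ [cup 0, cross 0 c, cup 2, cup 0, cross 2 c, cap 1, cap 1, cap 0] :=
      move_symm [cup 0] [cup 0, cross 2 c, cap 1, cap 1, cap 0] (exchange (.cross c) .cup 0 0) rfl
        rfl
    _ ∼ [cup 0, cup 2, cup 0, cross 2 c, cap 1, cap 1, cap 0] :=
      move [] [cup 2, cup 0, cross 2 c, cap 1, cap 1, cap 0] (reidemeister₁ 0 c) rfl rfl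
    _ ∼ [cup 0, cup 2, cross 0 c, cup 0, cap 1, cap 1, cap 0] :=
      move [cup 0, cup 2] [cap 1, cap 1, cap 0] (exchange .cup (.cross c) 0 0) rfl rfl
    _ ∼ [cup 0, cross 0 c, cup 2, cup 0, cap 1, cap 1, cap 0] :=
      move_symm [cup 0] [cup 0, cap 1, cap 1, cap 0] (exchange (.cross c) .cup 0 0) rfl rfl
    _ ∼ [cup 0, cup 2, cup 0, cap 1, cap 1, cap 0] :=
      move [] [cup 2, cup 0, cap 1, cap 1, cap 0] (reidemeister₁ 0 c) rfl rfl
    _ ∼ [cup 0, cup 2, cap 1, cap 0] :=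
      move [cup 0, cup 2] [cap 1, cap 0] (zigzag 0) rfl rfl
    _ ∼ [cup 0, cap 0] :=
      move [cup 0] [cap 0] (zigzag' 1) rfl rfl

/-- The `2 1` knot is a trefoil knot. -/
theorem similar_two_one : [cup 0, cup 2, cup 2, cross 1 c, cross 3 c, cap 2, cross 1 c, cap 0, cap
  0] ∼ [cup 0, cup 2, cross 1 (!c), cross 1 (!c), cross 1 (!c), cap 0, cap 0] :=
  calc [cup 0, cup 2, cup 2, cross 1 c, cross 3 c, cap 2, cross 1 c, cap 0, cap 0]
    _ ∼ [cup 0, cup 2, cup 2, cross 1 c, cross 2 (!c), cap 3, cross 1 c, cap 0, cap 0] :=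
      move [cup 0, cup 2, cup 2, cross 1 c] [cross 1 c, cap 0, cap 0] (pivotCap 2 c) rfl rfl
    _ ∼ [cup 0, cup 2, cup 1, cross 2 (!c), cross 2 (!c), cap 3, cross 1 c, cap 0, cap 0] :=
      move_symm [cup 0, cup 2] [cross 2 (!c), cap 3, cross 1 c, cap 0, cap 0] (pivotCup_not 1 c)
        rfl rfl
    _ ∼ [cup 0, cup 2, cup 1, cross 2 (!c), cross 2 (!c), cap 3, cross 0 (!c), cap 1, cap 0] :=
      move [cup 0, cup 2, cup 1, cross 2 (!c), cross 2 (!c), cap 3] [cap 0] (pivotCap 0 c) rfl rfl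
    _ ∼ [cup 0, cup 2, cup 1, cross 2 (!c), cross 2 (!c), cross 0 (!c), cap 3, cap 1, cap 0] :=
      move_symm [cup 0, cup 2, cup 1, cross 2 (!c), cross 2 (!c)] [cap 1, cap 0] (exchange (.cross
        (!c)) .cap 0 1) rfl rfl
    _ ∼ [cup 0, cup 2, cup 1, cross 2 (!c), cross 0 (!c), cross 2 (!c), cap 3, cap 1, cap 0] :=
      move_symm [cup 0, cup 2, cup 1, cross 2 (!c)] [cap 3, cap 1, cap 0] (exchange (.cross (!c))
        (.cross (!c)) 0 0) rfl rfl
    _ ∼ [cup 0, cup 2, cup 1, cross 0 (!c), cross 2 (!c), cross 2 (!c), cap 3, cap 1, cap 0] :=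
      move_symm [cup 0, cup 2, cup 1] [cross 2 (!c), cap 3, cap 1, cap 0] (exchange (.cross (!c))
        (.cross (!c)) 0 0) rfl rfl
    _ ∼ [cup 0, cup 0, cup 1, cross 0 (!c), cross 2 (!c), cross 2 (!c), cap 3, cap 1, cap 0] :=
      move [] [cup 1, cross 0 (!c), cross 2 (!c), cross 2 (!c), cap 3, cap 1, cap 0] (exchange .cup
        .cup 0 0) rfl rfl
    _ ∼ [cup 0, cup 0, cup 0, cross 1 c, cross 2 (!c), cross 2 (!c), cap 3, cap 1, cap 0] :=
      move_symm [cup 0, cup 0] [cross 2 (!c), cross 2 (!c), cap 3, cap 1, cap 0] (pivotCup 0 c) rfl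
        rfl
    _ ∼ [cup 0, cup 0, cup 2, cross 1 c, cross 2 (!c), cross 2 (!c), cap 3, cap 1, cap 0] :=
      move_symm [cup 0] [cross 1 c, cross 2 (!c), cross 2 (!c), cap 3, cap 1, cap 0] (exchange .cup
        .cup 0 0) rfl rfl
    _ ∼ [cup 0, cup 0, cup 1, cross 2 (!c), cross 2 (!c), cross 2 (!c), cap 3, cap 1, cap 0] :=
      move_symm [cup 0, cup 0] [cross 2 (!c), cross 2 (!c), cap 3, cap 1, cap 0] (pivotCup_not 1 c)
        rfl rfl
    _ ∼ [cup 0, cup 2, cup 1, cross 2 (!c), cross 2 (!c), cross 2 (!c), cap 3, cap 1, cap 0] :=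
      move_symm [] [cup 1, cross 2 (!c), cross 2 (!c), cross 2 (!c), cap 3, cap 1, cap 0] (exchange
        .cup .cup 0 0) rfl rfl
    _ ∼ [cup 0, cup 1, cup 4, cross 2 (!c), cross 2 (!c), cross 2 (!c), cap 3, cap 1, cap 0] :=
      move_symm [cup 0] [cross 2 (!c), cross 2 (!c), cross 2 (!c), cap 3, cap 1, cap 0] (exchange
        .cup .cup 1 1) rfl rfl
    _ ∼ [cup 0, cup 1, cross 2 (!c), cup 4, cross 2 (!c), cross 2 (!c), cap 3, cap 1, cap 0] :=
      move_symm [cup 0, cup 1] [cross 2 (!c), cross 2 (!c), cap 3, cap 1, cap 0] (exchange (.cross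
        (!c)) .cup 2 0) rfl rfl
    _ ∼ [cup 0, cup 1, cross 2 (!c), cross 2 (!c), cup 4, cross 2 (!c), cap 3, cap 1, cap 0] :=
      move_symm [cup 0, cup 1, cross 2 (!c)] [cross 2 (!c), cap 3, cap 1, cap 0] (exchange (.cross
        (!c)) .cup 2 0) rfl rfl
    _ ∼ [cup 0, cup 1, cross 2 (!c), cross 2 (!c), cross 2 (!c), cup 4, cap 3, cap 1, cap 0] :=
      move_symm [cup 0, cup 1, cross 2 (!c), cross 2 (!c)] [cap 3, cap 1, cap 0] (exchange (.cross
        (!c)) .cup 2 0) rfl rfl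
    _ ∼ [cup 0, cup 1, cross 2 (!c), cross 2 (!c), cross 2 (!c), cap 1, cap 0] :=
      move [cup 0, cup 1, cross 2 (!c), cross 2 (!c), cross 2 (!c)] [cap 1, cap 0] (zigzag' 3) rfl
        rfl
    _ ∼ [cup 0, cup 2, cross 1 c, cross 2 (!c), cross 2 (!c), cap 1, cap 0] :=
      move [cup 0] [cross 2 (!c), cross 2 (!c), cap 1, cap 0] (pivotCup_not 1 c) rfl rfl
    -- The aim is to move the twist from strands 2, 3 to strands 1, 2. Write `σ₁`, `σ₂` for the
    -- crossings with label `c` at positions 1 and 2. The inserted pair and the next pivot produce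
    -- the conjugate `σ₁ σ₂⁻³ σ₁⁻¹`. Three uses of `σ₁ σ₂⁻¹ σ₁⁻¹ = σ₂⁻¹ σ₁⁻¹ σ₂`, a Reidemeister III
    -- move, turn it into `σ₂⁻¹ σ₁⁻³ σ₂`, whose outer crossings are kinks.
    _ ∼ [cup 0, cup 2, cross 1 c, cross 2 (!c), cross 2 (!c), cross 2 (!c), cross 2 c, cap 1, cap
      0] :=
      move_symm [cup 0, cup 2, cross 1 c, cross 2 (!c), cross 2 (!c)] [cap 1, cap 0]
        (reidemeister₂_not 2 c) rfl rfl
    _ ∼ [cup 0, cup 2, cross 1 c, cross 2 (!c), cross 2 (!c), cross 2 (!c), cross 1 (!c), cap 2,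
      cap 0] :=
      move [cup 0, cup 2, cross 1 c, cross 2 (!c), cross 2 (!c), cross 2 (!c)] [cap 0] (pivotCap 1
        c) rfl rfl
    _ ∼ [cup 0, cup 2, cross 1 c, cross 2 (!c), cross 1 (!c), cross 1 c, cross 2 (!c), cross 2
      (!c), cross 1 (!c), cap 2, cap 0] :=
      move_symm [cup 0, cup 2, cross 1 c, cross 2 (!c)] [cross 2 (!c), cross 2 (!c), cross 1 (!c),
        cap 2, cap 0] (reidemeister₂_not 1 c) rfl rfl
    _ ∼ [cup 0, cup 2, cross 1 c, cross 2 (!c), cross 1 (!c), cross 1 c, cross 2 (!c), cross 1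
      (!c), cross 1 c, cross 2 (!c), cross 1 (!c), cap 2, cap 0] :=
      move_symm [cup 0, cup 2, cross 1 c, cross 2 (!c), cross 1 (!c), cross 1 c, cross 2 (!c)]
        [cross 2 (!c), cross 1 (!c), cap 2, cap 0] (reidemeister₂_not 1 c) rfl rfl
    _ ∼ [cup 0, cup 2, cross 2 (!c), cross 1 (!c), cross 2 c, cross 1 c, cross 2 (!c), cross 1
      (!c), cross 1 c, cross 2 (!c), cross 1 (!c), cap 2, cap 0] :=
      move [cup 0, cup 2] [cross 1 c, cross 2 (!c), cross 1 (!c), cross 1 c, cross 2 (!c), cross 1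
        (!c), cap 2, cap 0] (reidemeister₃ 1 c (!c) (!c) (.inr rfl)) rfl rfl
    _ ∼ [cup 0, cup 2, cross 2 (!c), cross 1 (!c), cross 2 c, cross 2 (!c), cross 1 (!c), cross 2
      c, cross 1 c, cross 2 (!c), cross 1 (!c), cap 2, cap 0] :=
      move [cup 0, cup 2, cross 2 (!c), cross 1 (!c), cross 2 c] [cross 1 c, cross 2 (!c), cross 1
        (!c), cap 2, cap 0] (reidemeister₃ 1 c (!c) (!c) (.inr rfl)) rfl rfl
    _ ∼ [cup 0, cup 2, cross 2 (!c), cross 1 (!c), cross 2 c, cross 2 (!c), cross 1 (!c), cross 2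
      c, cross 2 (!c), cross 1 (!c), cross 2 c, cap 2, cap 0] :=
      move [cup 0, cup 2, cross 2 (!c), cross 1 (!c), cross 2 c, cross 2 (!c), cross 1 (!c), cross
        2 c] [cap 2, cap 0] (reidemeister₃ 1 c (!c) (!c) (.inr rfl)) rfl rfl
    _ ∼ [cup 0, cup 2, cross 2 (!c), cross 1 (!c), cross 2 c, cross 2 (!c), cross 1 (!c), cross 1
      (!c), cross 2 c, cap 2, cap 0] :=
      move [cup 0, cup 2, cross 2 (!c), cross 1 (!c), cross 2 c, cross 2 (!c), cross 1 (!c)] 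
      [cross 1 (!c), cross 2 c, cap 2, cap 0] (reidemeister₂ 2 c) rfl rfl
    _ ∼ [cup 0, cup 2, cross 2 (!c), cross 1 (!c), cross 1 (!c), cross 1 (!c), cross 2 c, cap 2,
      cap 0] :=
      move [cup 0, cup 2, cross 2 (!c), cross 1 (!c)] [cross 1 (!c), cross 1 (!c), cross 2 c, cap
        2, cap 0] (reidemeister₂ 2 c) rfl rfl
    _ ∼ [cup 0, cup 2, cross 2 (!c), cross 1 (!c), cross 1 (!c), cross 1 (!c), cap 2, cap 0] :=
      move [cup 0, cup 2, cross 2 (!c), cross 1 (!c), cross 1 (!c), cross 1 (!c)] [cap 0]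
        (reidemeister₁' 2 c) rfl rfl
    _ ∼ [cup 0, cup 2, cross 1 (!c), cross 1 (!c), cross 1 (!c), cap 2, cap 0] :=
      move [cup 0] [cross 1 (!c), cross 1 (!c), cross 1 (!c), cap 2, cap 0] (reidemeister₁ 2 (!c))
        rfl rfl
    _ ∼ [cup 0, cup 2, cross 1 (!c), cross 1 (!c), cross 1 (!c), cap 0, cap 0] :=
      move_symm [cup 0, cup 2, cross 1 (!c), cross 1 (!c), cross 1 (!c)] [] (exchange .cap .cap 0
        0) rfl rfl

end Isotopies


/-! ### Reduction of an arbitrary horizontal twist -/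

theorem runs_twist (ls : List Bool) : Runs 4 (ls.map (cross 1)) 4 := by
  induction ls with
  | nil => exact rfl
  | cons c ls ih => exact ⟨1, rfl, ih⟩

theorem runs_assignmentWord (a b : Bool) (ls : List Bool) :
    Runs 0 (assignmentWord a b ls) 0 :=
  .append (.append (finish_eq_some_iff.1 rfl) (runs_twist ls))
    (finish_eq_some_iff.1 (rfl : _ = some 4))

/-- The opposite crossings of a horizontal twist cancel. -/
theorem exists_similar_replicate (ls : List Bool) : ∃ (c : Bool) (j : ℕ),
    ls.count c = ls.count (!c) + j ∧
      Similar 4 4 (ls.map (cross 1)) (List.replicate j (cross 1 c)) := by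
  induction ls with
  | nil => exact ⟨true, 0, rfl, .refl rfl⟩
  | cons x ls ih =>
    obtain ⟨c, j, hj, h⟩ := ih
    have h' := h.append_left (u := [cross 1 x]) (k := 4) ⟨1, rfl, rfl⟩
    by_cases hx : x = c
    · subst hx
      refine ⟨x, j + 1, ?_, ?_⟩
      · simp only [List.count_cons_self, List.count_cons]
        simp
        omega
      · simpa [List.replicate_succ] using h'
    · obtain rfl : x = !c := by cases x <;> cases c <;> simp_all
      cases j with
      | zero =>
        -- With no surplus so far, the surplus label may be chosen anew.
        refine ⟨!c, 1, ?_, by simpa using h'⟩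
        simp
        omega
      | succ j =>
        refine ⟨c, j, ?_, ?_⟩
        · simp
          omega
        · refine Similar.trans (by simpa [List.replicate_succ] using h') ?_
          have hr : Runs 4 (List.replicate j (cross 1 c)) 4 := by
            simpa using runs_twist (List.replicate j c)
          exact (of_localMove (m := 4) (n := 4) (reidemeister₂_not 1 c) rfl rfl).append_right hr

/-- Strands 1 and 2 are the ends of the inner arc, so each crossing in turn is a kink. -/
theorem similar_cup_twist (ls : List Bool) :
    Similar 0 4 ([cup 0, cup 1] ++ ls.map (cross 1)) [cup 0, cup 1] := by
  induction ls with
  | nil => exact .refl (finish_eq_some_iff.1 rfl)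
  | cons c ls ih =>
    refine Similar.trans ?_ ih
    exact (move (m := 0) (n := 4) [cup 0] [] (reidemeister₁ 1 c) rfl rfl).append_right
      (runs_twist ls)

theorem similar_assignmentWord_ne (a : Bool) (ls : List Bool) :
    Similar 0 0 (assignmentWord a (!a) ls) [cup 0, cap 0] := by
  have hT : Runs 4 (ls.map (cross 1) ++ [cap 0, cap 0]) 0 :=
    .append (finish_eq_some_iff.1 rfl) (runs_twist ls)
  refine ((similar_of_vertical_ne a).append_right hT).trans ?_
  rw [← List.append_assoc]
  refine ((similar_cup_twist ls).append_right (finish_eq_some_iff.1 rfl)).trans ?_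
  exact move (m := 0) (n := 0) [cup 0] [cap 0] (zigzag' 0) rfl rfl

theorem similar_assignmentWord_replicate {a b c : Bool} {ls : List Bool} {j : ℕ}
    (h : Similar 4 4 (ls.map (cross 1)) (List.replicate j (cross 1 c))) :
    Similar 0 0 (assignmentWord a b ls) (assignmentWord a b (List.replicate j c)) := by
  have := (h.append_right (v := [cap 0, cap 0]) (k := 0) (finish_eq_some_iff.1 rfl)).append_left
    (u := [cup 0, cup 2, cup 2, cross 1 a, cross 3 b, cap 2]) (k := 0) (finish_eq_some_iff.1 rfl)
  simpa [assignmentWord] using this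

theorem similar_assignmentWord_of_count_eq {a : Bool} {ls : List Bool}
    (h : ls.count a = ls.count (!a)) :
    Similar 0 0 (assignmentWord a a ls) [cup 0, cap 0] := by
  obtain ⟨c, j, hj, hs⟩ := exists_similar_replicate ls
  obtain rfl : j = 0 := by cases a <;> cases c <;> simp at h hj <;> omega
  exact (similar_assignmentWord_replicate hs).trans (similar_two_zero a)

theorem similar_assignmentWord_of_count_not {a : Bool} {ls : List Bool}
    (h : ls.count (!a) = ls.count a + 1) :
    Similar 0 0 (assignmentWord a a ls) [cup 0, cap 0] := by
  obtain ⟨c, j, hj, hs⟩ := exists_similar_replicate ls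
  obtain ⟨rfl, rfl⟩ : j = 1 ∧ c = !a := by
    cases a <;> cases c <;> simp at h hj ⊢ <;> omega
  exact (similar_assignmentWord_replicate hs).trans (similar_two_neg_one a)

theorem similar_assignmentWord_trefoil {a : Bool} {ls : List Bool}
    (h : ls.count a = ls.count (!a) + 1) :
    Similar 0 0 (assignmentWord a a ls) (Tangle.twist (!a) 3).closure.word := by
  obtain ⟨c, j, hj, hs⟩ := exists_similar_replicate ls
  obtain ⟨rfl, rfl⟩ : j = 1 ∧ c = a := by
    cases a <;> cases c <;> simp at h hj ⊢ <;> omega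
  exact (similar_assignmentWord_replicate hs).trans (similar_two_one c)

/-! ### Classification of the assignments -/

/-- The assignment of the free `2 n` knot with the word `assignmentWord a b ls`. -/
def assignment (a b : Bool) (ls : List Bool) : LinkDiagram :=
  ⟨assignmentWord a b ls, runs_assignmentWord a b ls⟩

theorem Similar.equivalent {m n : ℕ} {D E : Tangle Bool m n}
    (h : Similar m n D.word E.word) : Equivalent D E := h.2.2

/-- Colouring numbers over all `ZMod m` recover the determinant: taking `m` to be either of the two
candidates makes it act as zero, hence also the other, so the two divide each other. -/
theorem natAbs_of_colorings {a : Bool} {ls : List Bool} {D : LinkDiagram} {q : ℕ}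
    (h : Equivalent (assignment a a ls) D) (hq : q ≠ 0)
    (hD : ∀ m : ℕ, [NeZero m] → colorings D.word (fun _ => (0 : ZMod m)) =
      Fintype.card (ZMod m) * (Finset.univ.filter fun t : ZMod m => (q : ZMod m) * t = 0).card) :
    (2 * ((ls.count a : ℤ) - ls.count (!a)) + 1).natAbs = q := by
  set d : ℤ := 2 * ((ls.count a : ℤ) - ls.count (!a)) + 1 with hd
  have key (m : ℕ) [NeZero m] :
      (Finset.univ.filter fun t : ZMod m => (d : ZMod m) * t = 0).card =
        (Finset.univ.filter fun t : ZMod m => (q : ZMod m) * t = 0).card := by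
    have h1 := h.colorings_eq (fun _ => (0 : ZMod m))
    rw [hD m] at h1
    have h2 := colorings_assignmentWord (A := ZMod m) a ls
    rw [assignment, h2] at h1
    have h3 := Nat.eq_of_mul_eq_mul_left Fintype.card_pos h1
    rw [← h3, hd]
    push_cast
    rfl
  -- If `x = 0`, every `t` is a solution, so by equality of cardinalities `t = 1` also solves `y * t
  -- = 0`.
  have full {m : ℕ} [NeZero m] (x y : ZMod m) (hx : x = 0)
      (hxy : (Finset.univ.filter fun t : ZMod m => x * t = 0).card =
        (Finset.univ.filter fun t : ZMod m => y * t = 0).card) : y = 0 := by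
    simp only [hx, zero_mul, Finset.filter_true] at hxy
    have h1 := Finset.filter_card_eq hxy.symm 1 (Finset.mem_univ _)
    simpa using h1
  apply Nat.dvd_antisymm
  -- The integer `d` is odd, hence nonzero.
  · have : NeZero d.natAbs := ⟨by omega⟩
    have := full (d : ZMod d.natAbs) (q : ZMod d.natAbs)
      (by rw [ZMod.intCast_zmod_eq_zero_iff_dvd, Int.natCast_dvd]) (key _)
    rwa [ZMod.natCast_eq_zero_iff] at this
  · have : NeZero q := ⟨hq⟩
    have := full (q : ZMod q) (d : ZMod q) (by simp) (key q).symm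
    rwa [ZMod.intCast_zmod_eq_zero_iff_dvd, Int.natCast_dvd] at this

theorem isUnknot_assignment_iff (a b : Bool) (ls : List Bool) :
    IsUnknot (assignment a b ls) ↔
      a = b → ls.count a = ls.count (!a) ∨ ls.count (!a) = ls.count a + 1 := by
  constructor
  · rintro h rfl
    have := natAbs_of_colorings (q := 1) h one_ne_zero fun m _ => by
      rw [colorings_circle]; simp [Finset.filter_eq']
    omega
  · intro h
    by_cases hab : a = b
    · subst hab
      rcases h rfl with h | h
      · exact Similar.equivalent (similar_assignmentWord_of_count_eq h)
      · exact Similar.equivalent (similar_assignmentWord_of_count_not h)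
    · obtain rfl : b = !a := by cases a <;> cases b <;> simp_all
      exact Similar.equivalent (similar_assignmentWord_ne a ls)

theorem colorings_eq_of_isUnknot {D : LinkDiagram} (h : IsUnknot D) (m : ℕ) [NeZero m] :
    colorings D.word (fun _ => (0 : ZMod m)) = Fintype.card (ZMod m) := by
  rw [Equivalent.colorings_eq h, colorings_circle]

/-- Determinant 3 allows the signed counts `1` and `-2`. Odd length rules out `-2`, which would
otherwise have to be identified separately. -/
theorem isTrefoil_assignment_iff {a b : Bool} {ls : List Bool} (hls : Odd ls.length) :
    IsTrefoil (assignment a b ls) ↔ a = b ∧ ls.count a = ls.count (!a) + 1 := by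
  constructor
  · rintro ⟨c, h⟩
    have hab : a = b := by
      by_contra hab
      -- With mixed vertical labels the diagram is an unknot, with 3 colourings over `ZMod 3`,
      -- whereas the trefoil has 9.
      have h1 := colorings_eq_of_isUnknot
        ((isUnknot_assignment_iff a b ls).2 fun h => absurd h hab) 3
      rw [h.colorings_eq, colorings_closure_twist_three] at h1
      revert h1
      decide
    subst hab
    have h1 := natAbs_of_colorings (q := 3) h three_ne_zero fun m _ =>
      colorings_closure_twist_three c
    obtain ⟨k, hk⟩ := hls
    have := List.count_not_add_count ls a
    exact ⟨rfl, by omega⟩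
  · rintro ⟨rfl, h⟩
    exact ⟨_, Similar.equivalent (similar_assignmentWord_trefoil h)⟩

/-! ### Enumeration of the assignments and the final count -/

theorem exists_cross_of_map_eq {i : ℕ} {s : Slice Bool}
    (h : s.map (fun _ => ()) = cross i ()) : ∃ c, s = cross i c := by
  obtain ⟨_ | _ | c, j⟩ := s <;> simp_all [Slice.map, Event.map, cross]

theorem eq_cup_of_map_eq {i : ℕ} {s : Slice Bool}
    (h : s.map (fun _ => ()) = cup i) : s = cup i := by
  obtain ⟨_ | _ | c, j⟩ := s <;> simp_all [Slice.map, Event.map, cup]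

theorem eq_cap_of_map_eq {i : ℕ} {s : Slice Bool}
    (h : s.map (fun _ => ()) = cap i) : s = cap i := by
  obtain ⟨_ | _ | c, j⟩ := s <;> simp_all [Slice.map, Event.map, cap]

theorem exists_ofFn_of_map_eq {n : ℕ} {w : List (Slice Bool)}
    (h : w.map (Slice.map fun _ => ()) = List.replicate n (cross 1 ())) :
    ∃ f : Fin n → Bool, w = (List.ofFn f).map (cross 1) := by
  induction n generalizing w with
  | zero => exact ⟨Fin.elim0, by simpa using h⟩
  | succ n ih =>
    rw [List.replicate_succ, List.map_eq_cons_iff] at h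
    obtain ⟨s, w, rfl, hs, hw⟩ := h
    obtain ⟨c, rfl⟩ := exists_cross_of_map_eq hs
    obtain ⟨f, rfl⟩ := ih hw
    exact ⟨Fin.cons c f, by simp⟩

theorem freeTwoKnot_word (n : ℕ) : (freeTwoKnot n).word =
    cup 0 :: cup 2 :: cup 2 :: cross 1 () :: cross 3 () :: cap 2 ::
      (List.replicate n (cross 1 ()) ++ [cap 0, cap 0]) := by
  simp [freeTwoKnot, freeTwoTangle, Tangle.append, Tangle.closure,
    Tangle.twist, Tangle.twoReflected, Slice.shift, cup, cap, cross]

/-- The assignments of the free `2 n` knot correspond to the labels of its crossings. -/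
theorem shape_eq_freeTwoKnot_iff {n : ℕ} {D : LinkDiagram} :
    D.shape = freeTwoKnot n ↔
      ∃ (a b : Bool) (f : Fin n → Bool), D = assignment a b (List.ofFn f) := by
  constructor
  · intro h
    have h1 : D.word.map (Slice.map fun _ => ()) = _ :=
      (congrArg Tangle.word h).trans (freeTwoKnot_word n)
    simp only [List.map_eq_cons_iff, List.map_eq_append_iff, List.map_eq_nil_iff] at h1
    obtain ⟨s₁, _, hD, h₁, s₂, _, rfl, h₂, s₃, _, rfl, h₃, s₄, _, rfl, h₄, s₅, _, rfl, h₅,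
      s₆, _, rfl, h₆, w, _, rfl, hw, s₇, _, rfl, h₇, s₈, _, rfl, h₈, rfl⟩ := h1
    obtain ⟨a, rfl⟩ := exists_cross_of_map_eq h₄
    obtain ⟨b, rfl⟩ := exists_cross_of_map_eq h₅
    obtain ⟨f, rfl⟩ := exists_ofFn_of_map_eq hw
    obtain rfl := eq_cup_of_map_eq h₁
    obtain rfl := eq_cup_of_map_eq h₂
    obtain rfl := eq_cup_of_map_eq h₃
    obtain rfl := eq_cap_of_map_eq h₆
    obtain rfl := eq_cap_of_map_eq h₇
    obtain rfl := eq_cap_of_map_eq h₈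
    exact ⟨a, b, f, Tangle.ext hD⟩
  · rintro ⟨a, b, f, rfl⟩
    apply Tangle.ext
    rw [freeTwoKnot_word]
    simp [assignment, assignmentWord, Tangle.shape, Tangle.map, Slice.map, cup, cap, cross,
      Event.map, Function.comp_def]

theorem assignment_injective (n : ℕ) : Function.Injective
    fun p : Bool × Bool × (Fin n → Bool) => assignment p.1 p.2.1 (List.ofFn p.2.2) := by
  rintro ⟨a, b, f⟩ ⟨a', b', f'⟩ h
  have h1 := congrArg Tangle.word h
  have hinj : Function.Injective (cross (C := Bool) 1) := fun x y h => by simpa [cross] using h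
  simp only [assignment, assignmentWord, List.cons_append, List.nil_append, List.cons.injEq,
    List.append_cancel_right_eq, (List.map_injective_iff.2 hinj).eq_iff,
    List.ofFn_inj] at h1
  simp_all [cross]

theorem numberProduced_freeTwoKnot (n : ℕ) (P : LinkDiagram → Prop) :
    numberProduced (freeTwoKnot n) P =
      {p : Bool × Bool × (Fin n → Bool) | P (assignment p.1 p.2.1 (List.ofFn p.2.2))}.ncard := by
  rw [← Set.ncard_image_of_injective _ (assignment_injective n), numberProduced]
  congr 1
  ext D
  simp only [shape_eq_freeTwoKnot_iff, Set.mem_ofPred_eq, Set.mem_image, Prod.exists]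
  constructor
  · rintro ⟨⟨a, b, f, rfl⟩, h⟩
    exact ⟨a, b, f, h, rfl⟩
  · rintro ⟨a, b, f, h, rfl⟩
    exact ⟨⟨a, b, f, rfl⟩, h⟩

theorem card_count_eq (a : Bool) (j n : ℕ) :
    (Finset.univ.filter fun f : Fin n → Bool => (List.ofFn f).count a = j).card = n.choose j := by
  induction n generalizing j with
  | zero => cases j <;> simp
  | succ n ih =>
    rw [Finset.card_filter, ← (Fin.consEquiv fun _ => Bool).sum_comp, Fintype.sum_prod_type,
      Fintype.sum_bool]
    simp only [Fin.consEquiv_apply, List.ofFn_succ, Fin.cons_zero, Fin.cons_succ]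
    cases j with
    | zero =>
      have := ih 0
      rw [Finset.card_filter] at this
      cases a <;> simp_all
    | succ j =>
      have h0 := ih j
      have h1 := ih (j + 1)
      rw [Finset.card_filter] at h0 h1
      cases a <;> simp [h0, h1, Nat.choose_succ_succ, add_comm]

theorem numberProduced_eq_sum (n : ℕ) {P : LinkDiagram → Prop} (q : Bool → Bool → List Bool → Prop)
    [∀ a b ls, Decidable (q a b ls)]
    (h : ∀ a b ls, ls.length = n → (P (assignment a b ls) ↔ q a b ls)) :
    numberProduced (freeTwoKnot n) P =
      ∑ a, ∑ b, (Finset.univ.filter fun f : Fin n → Bool => q a b (List.ofFn f)).card := by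
  have hs : {p : Bool × Bool × (Fin n → Bool) | P (assignment p.1 p.2.1 (List.ofFn p.2.2))} =
      ↑(Finset.univ.filter fun p : Bool × Bool × (Fin n → Bool) =>
        q p.1 p.2.1 (List.ofFn p.2.2)) := by
    ext p
    simp [h _ _ (List.ofFn p.2.2) (List.length_ofFn)]
  rw [numberProduced_freeTwoKnot, hs, Set.ncard_coe_finset, Finset.card_filter,
    Fintype.sum_prod_type]
  simp only [Fintype.sum_prod_type, Finset.card_filter]

/-- Both mixed choices of vertical labels contribute all `2 ^ n` horizontal labellings, and both
equal choices contribute `n.choose j`. The hypothesis `h` expresses that the parity of `n` leaves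
one of the signed counts `0` and `-1`. -/
theorem numberProduced_isUnknot {n j : ℕ} (h : ∀ (a : Bool) (ls : List Bool), ls.length = n →
      (ls.count a = ls.count (!a) ∨ ls.count (!a) = ls.count a + 1 ↔ ls.count a = j)) :
    numberProduced (freeTwoKnot n) IsUnknot = 2 ^ (n + 1) + 2 * n.choose j := by
  rw [numberProduced_eq_sum n (fun a b ls => a = b → ls.count a = j) fun a b ls hls => by
    rw [isUnknot_assignment_iff, h a ls hls]]
  simp [card_count_eq]
  ring

/-- Counting the label `!a`, the minority when the signed count is 1, gives `j = (n - 1) / 2` and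
hence the same binomial coefficient as for the unknot. -/
theorem numberProduced_isTrefoil {n j : ℕ} (hn : Odd n)
    (h : ∀ (a : Bool) (ls : List Bool), ls.length = n →
      (ls.count a = ls.count (!a) + 1 ↔ ls.count (!a) = j)) :
    numberProduced (freeTwoKnot n) IsTrefoil = 2 * n.choose j := by
  rw [numberProduced_eq_sum n (fun a b ls => a = b ∧ ls.count (!a) = j) fun a b ls hls => by
    rw [isTrefoil_assignment_iff (hls ▸ hn), h a ls hls]]
  simp [card_count_eq]
  ring

end FreeKnot

theorem mainTheorem4 (n : ℕ) :
    (Odd n →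
      FreeKnot.numberProduced (FreeKnot.freeTwoKnot n) FreeKnot.IsUnknot
          = 2 ^ (n + 1) + 2 * n.choose ((n - 1) / 2) ∧
      FreeKnot.numberProduced (FreeKnot.freeTwoKnot n) FreeKnot.IsTrefoil
          = 2 * n.choose ((n - 1) / 2)) ∧
    (Even n →
      FreeKnot.numberProduced (FreeKnot.freeTwoKnot n) FreeKnot.IsUnknot
          = 2 ^ (n + 1) + 2 * n.choose (n / 2)) := by
  refine ⟨fun hn => ⟨FreeKnot.numberProduced_isUnknot fun a ls hls => ?_,
    FreeKnot.numberProduced_isTrefoil hn fun a ls hls => ?_⟩,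
    fun hn => FreeKnot.numberProduced_isUnknot fun a ls hls => ?_⟩ <;>
  · have := List.count_not_add_count ls a
    obtain ⟨k, hk⟩ := hn
    omega
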